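/- Let $\mathfrak X$ be a connected complex manifold with a holomorphic action of $(\mathbb C^\times)^n$, let $\pi\colon \mathfrak X\to\mathbb C^n$ be a holomorphic proper submersion that is equivariant with respect to the coordinatewise multiplication action of $(\mathbb C^\times)^n$ on $\mathbb C^n$, and let $\mathfrak L\to\mathfrak X$ be a $(\mathbb C^\times)^n$-equivariant holomorphic line bundle (that is, $(\mathbb C^\times)^n$ acts holomorphically on $\mathfrak L$, linearly on the fibres and covering the action on $\mathfrak X$). Write $\mathbf 0=(0,\dots,0)$, $\mathbf 1=(1,\dots,1)$, $X_{\mathbf t}=\pi^{-1}(\mathbf t)$ and $\mathfrak X_{\mathrm{reg}}=\pi^{-1}((\mathbb C^\times)^n)$. Assume that for every $j\in\{1,\dots,n\}$ the action of the $j$-th factor of $(\mathbb C^\times)^n$ on the special fibre $X_{\mathbf 0}$ has a fixed point $p$ at which all the isotropy weights (the weights of the resulting linear $\mathbb C^\times$-representation on $T_pX_{\mathbf 0}$) are non-positive. For a holomorphic section $s$ of $\mathfrak L|_{X_{\mathbf 1}}$ over $X_{\mathbf 1}$, let $\tilde s$ be its sweep, the holomorphic section of $\mathfrak L$ over $\mathfrak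 X_{\mathrm{reg}}$ given by $$\tilde s(x)=\tau\cdot s(\tau^{-1}\cdot x),\qquad \tau=\pi(x)\in(\mathbb C^\times)^n,$$ and let $t_j$ denote the $j$-th coordinate of $\pi$. Then for every holomorphic section $s$ of $\mathfrak L|_{X_{\mathbf 1}}$ and every $j\in\{1,\dots,n\}$ there exists an integer $\ell_j$ such that the section $t_j^{-\ell_j}\tilde s$ of $\mathfrak L$ over $\mathfrak X_{\mathrm{reg}}$ extends to a holomorphic section of $\mathfrak L$ over $$\pi^{-1}\bigl(\mathbb C^\times\times\cdots\times\mathbb C^\times\times\mathbb C_{j\text{th}}\times\mathbb C^\times\times\cdots\times\mathbb C^\times\bigr),$$ where the factor $\mathbb C$ is in the $j$-th place. -/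

import Mathlib

open Bundle Set
open scoped Manifold ContDiff Topology

/-- The set `(ℂ^×)^n` as an open subset of `ℂ^n`. -/
def regBase (n : ℕ) : Set (Fin n → ℂ) := {t | ∀ i, t i ≠ 0}

/-- The set `ℂ^× × ⋯ × ℂ × ⋯ × ℂ^×` with the factor `ℂ` in the `j`-th place. -/
def partialBase (n : ℕ) (j : Fin n) : Set (Fin n → ℂ) := {t | ∀ i, i ≠ j → t i ≠ 0}

/-- The element of the group `(ℂ^×)^n` given by a point of `(ℂ^×)^n ⊆ ℂ^n`; coordinates that
vanish (which never happens on `regBase n`) are replaced by `1`. -/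
noncomputable def torusPoint {n : ℕ} (t : Fin n → ℂ) : Fin n → ℂˣ :=
  fun i => if h : t i = 0 then 1 else Units.mk0 (t i) h

/-- An action of the complex Lie group `(ℂ^×)^n` on a complex manifold `Y` is holomorphic if the
action map `(ℂ^×)^n × Y → Y` is holomorphic; here `(ℂ^×)^n` carries its complex structure as an
open subset of `ℂ^n`. -/
def IsHolomorphicTorusAction (n : ℕ) {F H : Type*} [NormedAddCommGroup F] [NormedSpace ℂ F]
    [TopologicalSpace H] (I : ModelWithCorners ℂ F H) (Y : Type*) [TopologicalSpace Y]
    [ChartedSpace H Y] [MulAction (Fin n → ℂˣ) Y] : Prop :=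
  ContMDiffOn (𝓘(ℂ, Fin n → ℂ).prod I) I ω
    (fun q : (Fin n → ℂ) × Y => torusPoint q.1 • q.2) (regBase n ×ˢ univ)

section Family

variable {n : ℕ} {E : Type*} [NormedAddCommGroup E] [NormedSpace ℂ E]
  {X : Type*} [TopologicalSpace X] [ChartedSpace E X] [MulAction (Fin n → ℂˣ) X]

/-- `L → X → ℂ^n` is an equivariant family over `ℂ^n`: `X` is a connected complex manifold (the
manifold structure itself is given by the instances) with a holomorphic `(ℂ^×)^n`-action, `pr` is an
equivariant holomorphic proper submersion, and the holomorphic line bundle `L` carries a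
holomorphic action of `(ℂ^×)^n` by maps that are linear on the fibres and cover the action
on `X`. -/
structure IsEquivariantFamily (pr : X → Fin n → ℂ) (L : X → Type*)
    [∀ x, AddCommGroup (L x)] [∀ x, Module ℂ (L x)] [TopologicalSpace (TotalSpace ℂ L)]
    [∀ x, TopologicalSpace (L x)] [FiberBundle ℂ L]
    [MulAction (Fin n → ℂˣ) (TotalSpace ℂ L)] : Prop where
  connected : ConnectedSpace X
  action_holomorphic : IsHolomorphicTorusAction n 𝓘(ℂ, E) X
  equivariant : ∀ (τ : Fin n → ℂˣ) (x : X) (i : Fin n), pr (τ • x) i = (τ i : ℂ) * pr x i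
  submersion : Manifold.IsSubmersion 𝓘(ℂ, E) 𝓘(ℂ, Fin n → ℂ) ω pr
  proper : IsProperMap pr
  bundle_action_holomorphic :
    IsHolomorphicTorusAction n (𝓘(ℂ, E).prod 𝓘(ℂ, ℂ)) (TotalSpace ℂ L)
  bundle_action_linear : ∀ (τ : Fin n → ℂˣ) (x : X), ∃ φ : L x →ₗ[ℂ] L (τ • x),
    ∀ v : L x, τ • (TotalSpace.mk' ℂ x v) = TotalSpace.mk' ℂ (τ • x) (φ v)

/-- `p` is fixed by the `j`-th factor of `(ℂ^×)^n`. -/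
def IsFactorFixedPoint (j : Fin n) (p : X) : Prop :=
  ∀ a : ℂˣ, (Pi.mulSingle j a : Fin n → ℂˣ) • p = p

/-- The integer `m` is a weight of the isotropy representation at `p`, a fixed point of the `j`-th
factor of `(ℂ^×)^n` with `pr p = 0`, on the tangent space at `p` to the fibre `pr⁻¹(0)`: there is a
non-zero vector `v`, tangent to this fibre (that is, in the kernel of the differential of `pr`), such
that the differential at `p` of the action of each `a ∈ ℂ^×` maps `v` to `a ^ m • v`. -/
def IsIsotropyWeight (pr : X → Fin n → ℂ) (j : Fin n) (p : X) (m : ℤ) : Prop :=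
  ∃ v : TangentSpace 𝓘(ℂ, E) p, v ≠ 0 ∧
    mfderiv 𝓘(ℂ, E) 𝓘(ℂ, Fin n → ℂ) pr p v = 0 ∧
    ∀ a : ℂˣ, mfderiv 𝓘(ℂ, E) 𝓘(ℂ, E) (fun x : X => (Pi.mulSingle j a : Fin n → ℂˣ) • x) p v
      = ((a : ℂ) ^ m) • v

/-- For every `j`, the action of the `j`-th factor of `(ℂ^×)^n` on the special fibre `pr⁻¹(0)` has
a fixed point at which all the isotropy weights are non-positive. -/
def MildTechnicalCondition (pr : X → Fin n → ℂ) : Prop :=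
  ∀ j : Fin n, ∃ p : X, pr p = 0 ∧ IsFactorFixedPoint j p ∧
    ∀ m : ℤ, IsIsotropyWeight (E := E) pr j p m → m ≤ 0

variable {L : X → Type*} [TopologicalSpace (TotalSpace ℂ L)]
  [∀ x, TopologicalSpace (L x)]

/-- `σ` restricts to a holomorphic section of `L` over the open subset `U` of `X`.  The values
of `σ` outside `U` are irrelevant. -/
def IsHolomorphicSectionOn [∀ x, Zero (L x)] [FiberBundle ℂ L]
    (U : Set X) (σ : X → TotalSpace ℂ L) : Prop :=
  (∀ x ∈ U, (σ x).proj = x) ∧ ContMDiffOn 𝓘(ℂ, E) (𝓘(ℂ, E).prod 𝓘(ℂ, ℂ)) ω σ U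

/-- `s` restricts to a holomorphic section of `L|_A` over the complex submanifold `A` of `X`:
near each point of `A`, it is the restriction to `A` of a holomorphic section of `L` over an open
subset of `X`.  The values of `s` outside `A` are irrelevant. -/
def IsHolomorphicSectionOverSubmanifold [∀ x, Zero (L x)] [FiberBundle ℂ L]
    (A : Set X) (s : X → TotalSpace ℂ L) : Prop :=
  ∀ x ∈ A, ∃ U : Set X, IsOpen U ∧ x ∈ U ∧ ∃ σ : X → TotalSpace ℂ L,
    IsHolomorphicSectionOn (E := E) U σ ∧ EqOn s σ (A ∩ U)

/-- The sweep `x ↦ τ · s (τ⁻¹ · x)`, with `τ = pr x`, of a section `s` over `pr⁻¹(1,…,1)`. It is a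
section over `pr⁻¹((ℂ^×)^n)`; its values elsewhere are irrelevant. -/
noncomputable def sweep [MulAction (Fin n → ℂˣ) (TotalSpace ℂ L)]
    (pr : X → Fin n → ℂ) (s : X → TotalSpace ℂ L) : X → TotalSpace ℂ L :=
  fun x => torusPoint (pr x) • s ((torusPoint (pr x))⁻¹ • x)

/-- The twist `t_j ^ (-ℓ) σ` of a section `σ` over `pr⁻¹((ℂ^×)^n)`. -/
noncomputable def twist [∀ x, AddCommGroup (L x)] [∀ x, Module ℂ (L x)]
    (pr : X → Fin n → ℂ) (j : Fin n) (ℓ : ℤ) (σ : X → TotalSpace ℂ L) : X → TotalSpace ℂ L :=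
  fun x => TotalSpace.mk' ℂ (σ x).proj ((pr x j) ^ (-ℓ) • (σ x).snd)

end Family

/-! The sweep grows at most like a power of 1/|t_j| near t_j = 0. Properness of `pr` makes the
preimage K of `annularBase n j` compact, so finitely many trivializations over compact sets cover
it. Let τ act by 1/2 in the j-th coordinate. Read in these trivializations, τ enlarges norms in L by
at most a constant D. The sweep is bounded over the shell 1/2 ≤ |t_j| ≤ 1 of K, by compactness, and
its equivariance carries this bound inwards: each step halves |t_j| and costs a factor D. If D <
2^M, then |t_j|^M times the norm of the sweep stays bounded (`exists_sweep_growth`).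

Hence t_j^(M+2) times the sweep is O(|t_j|^2). Extended by zero, it is complex differentiable, with
zero derivative along t_j = 0 (`contMDiffAt_of_norm_le_sq`). In finite dimension differentiability
gives analyticity; this follows from Cauchy's formula by induction on the dimension
(`OsgoodProperty.prod`). So ℓ_j = -(M+2) works. -/

/-! ### Complex differentiable functions of several variables are analytic. -/

section Osgood

open Metric MeasureTheory intervalIntegral

/-- A continuous family of functions on a compact space which is pointwise holomorphic is
holomorphic for the supremum norm. -/
theorem ContinuousMap.differentiableOn_of_eval {K F : Type*} [TopologicalSpace K] [CompactSpace K]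
    [NormedAddCommGroup F] [NormedSpace ℂ F] [CompleteSpace F] {U : Set ℂ} (hU : IsOpen U)
    {g : ℂ → C(K, F)} (hg : ContinuousOn g U)
    (hd : ∀ k, DifferentiableOn ℂ (fun z => g z k) U) : DifferentiableOn ℂ g U := by
  intro z₀ hz₀
  obtain ⟨r, hr, hrU⟩ := nhds_basis_closedBall.mem_iff.1 (hU.mem_nhds hz₀)
  lift r to NNReal using hr.le
  have hr' : 0 < r := by exact_mod_cast hr
  have hgs : ContinuousOn g (sphere z₀ r) := hg.mono (sphere_subset_closedBall.trans hrU)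
  have hci : CircleIntegrable g z₀ r := hgs.circleIntegrable r.2
  -- The Cauchy integral of `g` has a power series merely because `g` is continuous on the circle.
  -- Evaluation at `k` commutes with the integral, so the scalar Cauchy formula identifies it with
  -- `g`.
  have hps := hasFPowerSeriesOn_cauchy_integral hci hr'
  refine (AnalyticAt.differentiableAt ?_).differentiableWithinAt
  refine (hps.analyticAt).congr ?_
  filter_upwards [ball_mem_nhds z₀ hr] with w hw
  ext k
  have hk : DifferentiableOn ℂ (fun z => g z k) (closedBall z₀ r) := (hd k).mono hrU
  have h1 := hk.circleIntegral_sub_inv_smul hw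
  have hne : ∀ z ∈ sphere z₀ (r : ℝ), z - w ≠ 0 := by
    intro z hz h
    rw [sub_eq_zero] at h
    subst h
    rw [mem_ball] at hw
    rw [mem_sphere] at hz
    exact absurd hz hw.ne
  have hci2 : CircleIntegrable (fun z => (z - w)⁻¹ • g z) z₀ r := by
    refine ContinuousOn.circleIntegrable r.2 ?_
    exact ((continuousOn_id.sub continuousOn_const).inv₀ hne).smul hgs
  have h2 : (∮ z in C(z₀, r), (z - w)⁻¹ • g z) k = ∮ z in C(z₀, r), (z - w)⁻¹ • g z k := by
    have := (ContinuousMap.evalCLM ℂ k : C(K, F) →L[ℂ] F).intervalIntegral_comp_comm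
      (CircleIntegrable.out hci2)
    rw [circleIntegral, circleIntegral]
    exact this.symm
  rw [ContinuousMap.smul_apply, h2, h1, smul_smul, inv_mul_cancel₀ Complex.two_pi_I_ne_zero,
    one_smul]

/-- The parametrization of a circle, as a map to the circle. -/
noncomputable def circleParam (c : ℂ) {r : ℝ} (hr : 0 ≤ r) (θ : ℝ) : sphere c r :=
  ⟨circleMap c r θ, circleMap_mem_sphere c hr θ⟩

theorem continuous_circleParam (c : ℂ) {r : ℝ} (hr : 0 ≤ r) : Continuous (circleParam c hr) :=
  (continuous_circleMap c r).subtype_mk _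

/-- The average over a circle of the product of a scalar function and a vector valued function, as
a continuous bilinear map. -/
noncomputable def circlePairing (F : Type*) [NormedAddCommGroup F] [NormedSpace ℂ F]
    (c : ℂ) {r : ℝ} (hr : 0 ≤ r) :
    C(sphere c r, ℂ) →L[ℂ] C(sphere c r, F) →L[ℂ] F :=
  have hint : ∀ (a : C(sphere c r, ℂ)) (g : C(sphere c r, F)), IntervalIntegrable
      (fun θ => a (circleParam c hr θ) • g (circleParam c hr θ)) volume 0 (2 * Real.pi) :=
    fun a g => (((a.continuous.comp (continuous_circleParam c hr)).smul
      (g.continuous.comp (continuous_circleParam c hr)))).intervalIntegrable _ _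
  LinearMap.mkContinuous₂
    (LinearMap.mk₂ ℂ (fun a g => (2 * Real.pi)⁻¹ • ∫ θ in 0..2 * Real.pi,
        a (circleParam c hr θ) • g (circleParam c hr θ))
      (fun a b g => by
        rw [← smul_add, ← intervalIntegral.integral_add (hint a g) (hint b g)]
        simp only [ContinuousMap.add_apply, add_smul])
      (fun t a g => by
        rw [smul_comm, ← intervalIntegral.integral_smul t]
        simp only [ContinuousMap.smul_apply, smul_assoc])
      (fun a g h => by
        rw [← smul_add, ← intervalIntegral.integral_add (hint a g) (hint a h)]
        simp only [ContinuousMap.add_apply, smul_add])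
      (fun t a g => by
        rw [smul_comm, ← intervalIntegral.integral_smul t]
        simp only [ContinuousMap.smul_apply]
        congr 2
        funext θ
        rw [smul_comm]))
    1 (fun a g => by
      rw [LinearMap.mk₂_apply, norm_smul, one_mul, Real.norm_of_nonneg (by positivity)]
      have : ‖∫ θ in 0..2 * Real.pi, a (circleParam c hr θ) • g (circleParam c hr θ)‖
          ≤ (‖a‖ * ‖g‖) * |2 * Real.pi - 0| := by
        refine norm_integral_le_of_norm_le_const fun θ _ => ?_
        rw [norm_smul]
        gcongr
        · exact a.norm_coe_le_norm _
        · exact g.norm_coe_le_norm _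
      rw [sub_zero, abs_of_pos Real.two_pi_pos] at this
      rw [inv_mul_le_iff₀ Real.two_pi_pos]
      linarith)

theorem circlePairing_apply {F : Type*} [NormedAddCommGroup F] [NormedSpace ℂ F]
    (c : ℂ) {r : ℝ} (hr : 0 ≤ r) (a : C(sphere c r, ℂ)) (g : C(sphere c r, F)) :
    circlePairing F c hr a g = (2 * Real.pi)⁻¹ • ∫ θ in 0..2 * Real.pi,
        a (circleParam c hr θ) • g (circleParam c hr θ) := rfl

/-- The identity function on a circle. -/
def sphereCoord (c : ℂ) (r : ℝ) : C(sphere c r, ℂ) := ⟨Subtype.val, continuous_subtype_val⟩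

/-- The averaged Cauchy kernel `z ↦ (z - c) / (z - w)` on a circle. -/
noncomputable def cauchyKernel (c : ℂ) (r : ℝ) (w : ℂ) : C(sphere c r, ℂ) :=
  (sphereCoord c r - algebraMap ℂ _ c) * Ring.inverse (sphereCoord c r - algebraMap ℂ _ w)

theorem isUnit_sphereCoord_sub {c w : ℂ} {r : ℝ} (hw : w ∈ ball c r) :
    IsUnit (sphereCoord c r - algebraMap ℂ C(sphere c r, ℂ) w) := by
  rw [ContinuousMap.isUnit_iff_forall_ne_zero]
  rintro ⟨z, hz⟩ h
  have : z = w := by simpa [sphereCoord, sub_eq_zero] using h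
  subst this
  exact absurd (mem_sphere.1 hz) (mem_ball.1 hw).ne

/-- Inversion in the Banach algebra of continuous functions on the circle is analytic at units, and
z - w is a unit for w in the open disc. -/
theorem analyticAt_cauchyKernel {c w : ℂ} {r : ℝ} (hw : w ∈ ball c r) :
    AnalyticAt ℂ (cauchyKernel c r) w := by
  have h1 : AnalyticAt ℂ (fun w => sphereCoord c r - algebraMap ℂ C(sphere c r, ℂ) w) w :=
    analyticAt_const.sub ((Algebra.linearMap ℂ C(sphere c r, ℂ)).toContinuousLinearMap.analyticAt w)
  obtain ⟨u, hu⟩ := isUnit_sphereCoord_sub hw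
  have h2 : AnalyticAt ℂ Ring.inverse (sphereCoord c r - algebraMap ℂ C(sphere c r, ℂ) w) := by
    rw [← hu]; exact analyticAt_inverse u
  exact analyticAt_const.mul (AnalyticAt.comp (f := fun w => sphereCoord c r - algebraMap ℂ C(sphere c r, ℂ) w) h2 h1)

theorem cauchyKernel_apply {c w : ℂ} {r : ℝ} (hw : w ∈ ball c r) (z : sphere c r) :
    cauchyKernel c r w z = ((z : ℂ) - c) / (z - w) := by
  have hu := isUnit_sphereCoord_sub hw
  have h := congrArg (fun f : C(sphere c r, ℂ) => f z) (Ring.mul_inverse_cancel _ hu)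
  simp only [ContinuousMap.mul_apply, ContinuousMap.one_apply] at h
  have h3 : (sphereCoord c r - algebraMap ℂ C(sphere c r, ℂ) w) z = z - w := rfl
  rw [h3] at h
  rw [cauchyKernel, ContinuousMap.mul_apply, eq_inv_of_mul_eq_one_right h, div_eq_mul_inv]
  rfl

/-- This is Cauchy's formula: on the circle dz = i(z - c)dθ, which accounts for the numerator z - c
of the kernel. -/
theorem circlePairing_cauchyKernel {F : Type*} [NormedAddCommGroup F] [NormedSpace ℂ F]
    [CompleteSpace F] {c w : ℂ} {r : ℝ} (hr : 0 < r) (hw : w ∈ ball c r) {f : ℂ → F}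
    (hf : DifferentiableOn ℂ f (closedBall c r)) (g : C(sphere c r, F))
    (hg : ∀ z : sphere c r, g z = f z) :
    circlePairing F c hr.le (cauchyKernel c r w) g = f w := by
  have hr' : |r| = r := abs_of_pos hr
  have h := DiffContOnCl.circleAverage_smul_div (f := f) (c := c) (R := r) (w := w)
    (by rw [hr']; exact (hf.mono closure_ball_subset_closedBall).diffContOnCl) (by rwa [hr'])
  rw [← h, circlePairing_apply, Real.circleAverage_def]
  simp only [cauchyKernel_apply hw, hg]
  rfl

universe u

/-- On `E`, continuous functions on open sets that are holomorphic along lines are analytic. -/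
def OsgoodProperty (E : Type*) [NormedAddCommGroup E] [NormedSpace ℂ E] : Prop :=
  ∀ (F : Type u) [NormedAddCommGroup F] [NormedSpace ℂ F] [CompleteSpace F] (f : E → F) (s : Set E),
    IsOpen s → ContinuousOn f s →
    (∀ x ∈ s, ∀ v, DifferentiableAt ℂ (fun ζ : ℂ => f (x + ζ • v)) 0) → AnalyticOnNhd ℂ f s

theorem OsgoodProperty.of_equiv {E E' : Type*} [NormedAddCommGroup E] [NormedSpace ℂ E]
    [NormedAddCommGroup E'] [NormedSpace ℂ E'] (e : E' ≃L[ℂ] E) (h : OsgoodProperty.{u} E) :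
    OsgoodProperty.{u} E' := by
  intro F _ _ _ f s hs hf hd x hx
  have h1 := h F (f ∘ e.symm) (e.symm ⁻¹' s) (hs.preimage e.symm.continuous)
    (hf.comp e.symm.continuous.continuousOn (fun _ h => h))
    (fun y hy v => by simpa using hd _ hy (e.symm v)) (e x) (by simpa using hx)
  have h2 := h1.comp (f := e) (e.toContinuousLinearMap.analyticAt x)
  refine h2.congr (Filter.Eventually.of_forall fun y => ?_)
  simp

theorem OsgoodProperty.of_subsingleton {E : Type*} [NormedAddCommGroup E] [NormedSpace ℂ E]
    [Subsingleton E] : OsgoodProperty.{u} E := by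
  intro F _ _ _ f s _ _ _ x _
  have : f = fun _ => f x := funext fun y => congrArg f (Subsingleton.elim _ _)
  rw [this]
  exact analyticAt_const

/-- Restricting the first variable to a circle turns `f` into a map `Φ` from `E` to continuous
functions on that circle, to which the hypothesis on `E` applies. This is why `OsgoodProperty`
allows every Banach target. Cauchy's formula in the first variable then recovers `f` from `Φ`. -/
theorem OsgoodProperty.prod {E : Type*} [NormedAddCommGroup E] [NormedSpace ℂ E]
    (h : OsgoodProperty.{u} E) : OsgoodProperty.{u} (ℂ × E) := by
  classical
  rintro F _ _ _ f s hs hf hd ⟨w₀, z₀⟩ hx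
  obtain ⟨r, hr, hrs⟩ := nhds_basis_closedBall.mem_iff.1 (hs.mem_nhds hx)
  rw [← closedBall_prod_same] at hrs
  have hsub : ∀ z ∈ ball z₀ r, ∀ w ∈ closedBall w₀ r, (w, z) ∈ s := fun z hz w hw =>
    hrs ⟨hw, ball_subset_closedBall hz⟩
  have hcont : ∀ z ∈ ball z₀ r, Continuous (fun w : sphere w₀ r => f (w, z)) := fun z hz =>
    hf.comp_continuous (by fun_prop) (fun w => hsub z hz w (sphere_subset_closedBall w.2))
  let Φ : E → C(sphere w₀ r, F) := fun z =>
    -- The value 0 is never taken on `ball z₀ r`, the only place where `Φ` is used.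
    if h : Continuous (fun w : sphere w₀ r => f (w, z)) then ⟨_, h⟩ else 0
  have hΦ : ∀ z ∈ ball z₀ r, ∀ w : sphere w₀ r, Φ z w = f (w, z) := fun z hz w => by
    simp only [Φ, dif_pos (hcont z hz)]; rfl
  have hΦc : ContinuousOn Φ (ball z₀ r) := by
    refine ContinuousMap.continuousOn_of_continuousOn_uncurry _ ?_
    have : ContinuousOn (fun p : E × sphere w₀ r => f (p.2, p.1)) (ball z₀ r ×ˢ univ) :=
      hf.comp (by fun_prop) (fun p hp => hsub _ hp.1 _ (sphere_subset_closedBall p.2.2))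
    exact this.congr fun p hp => hΦ _ hp.1 _
  -- The hypothesis `hd` only speaks of the parameter 0; moving the base point along the line gives
  -- every other parameter.
  have hline : ∀ x v (ζ : ℂ), x + ζ • v ∈ s →
      DifferentiableAt ℂ (fun ξ : ℂ => f (x + ξ • v)) ζ := by
    intro x v ζ hζ
    have h1 := hd _ hζ v
    have h2 : DifferentiableAt ℂ (fun ξ : ℂ => ξ - ζ) ζ := by fun_prop
    have h3 := DifferentiableAt.comp (f := fun ξ : ℂ => ξ - ζ) ζ
      (by rw [sub_self]; exact h1) h2
    refine h3.congr_of_eventuallyEq (Filter.Eventually.of_forall fun ξ => ?_)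
    simp only [Function.comp, sub_smul]
    congr 1
    abel
  have hΦa : AnalyticAt ℂ Φ z₀ := by
    refine h _ Φ (ball z₀ r) isOpen_ball hΦc ?_ z₀ (mem_ball_self hr)
    intro z hz v
    have hl : Continuous (fun ζ : ℂ => z + ζ • v) := by fun_prop
    have hU : IsOpen ((fun ζ : ℂ => z + ζ • v) ⁻¹' ball z₀ r) := isOpen_ball.preimage hl
    refine (ContinuousMap.differentiableOn_of_eval hU (hΦc.comp hl.continuousOn fun _ h => h)
      fun w ζ hζ => ?_).differentiableAt (hU.mem_nhds (by simpa using hz))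
    have := hline ((w : ℂ), z) (0, v) ζ (by
      simpa using hsub _ hζ w (sphere_subset_closedBall w.2))
    refine (this.congr_of_eventuallyEq ?_).differentiableWithinAt
    filter_upwards [hU.mem_nhds hζ] with ξ hξ
    rw [Function.comp, hΦ _ hξ]
    simp
  have hK : AnalyticAt ℂ (cauchyKernel w₀ r) w₀ := analyticAt_cauchyKernel (mem_ball_self hr)
  -- The pairing is continuous and bilinear, so separate analyticity of the kernel in w and of `Φ`
  -- in z gives joint analyticity.
  have hB := ((circlePairing F w₀ hr.le).analyticAt_bilinear
    (cauchyKernel w₀ r w₀, Φ z₀)).comp₂ (x := ((w₀, z₀) : ℂ × E))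
    (hK.comp (f := Prod.fst) analyticAt_fst) (hΦa.comp (f := Prod.snd) analyticAt_snd)
  refine hB.congr ?_
  filter_upwards [prod_mem_nhds (ball_mem_nhds w₀ hr) (ball_mem_nhds z₀ hr)]
  rintro ⟨w, z⟩ ⟨hw, hz⟩
  refine circlePairing_cauchyKernel (f := fun w => f (w, z)) hr hw (fun w hw => ?_) _ (hΦ z hz)
  have := hline (0, z) (1, 0) w (by simpa using hsub z hz w hw)
  simpa using this.differentiableWithinAt

theorem OsgoodProperty.pi : ∀ n : ℕ, OsgoodProperty.{u} (Fin n → ℂ)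
  | 0 => .of_subsingleton
  | n + 1 => .of_equiv (Fin.consEquivL ℂ fun _ : Fin (n + 1) => ℂ).symm (OsgoodProperty.pi n).prod

/-- A function that is complex differentiable on an open subset of a finite dimensional space is
analytic there. -/
theorem DifferentiableOn.analyticOnNhd_of_finiteDimensional {E F : Type*} [NormedAddCommGroup E]
    [NormedSpace ℂ E] [FiniteDimensional ℂ E] [NormedAddCommGroup F] [NormedSpace ℂ F]
    [CompleteSpace F] {f : E → F} {s : Set E} (hf : DifferentiableOn ℂ f s) (hs : IsOpen s) :
    AnalyticOnNhd ℂ f s := by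
  have e : E ≃L[ℂ] (Fin (Module.finrank ℂ E) → ℂ) := ContinuousLinearEquiv.ofFinrankEq (by simp)
  refine (OsgoodProperty.of_equiv e (.pi _)) F f s hs hf.continuousOn fun x hx v => ?_
  have h1 : DifferentiableAt ℂ f (x + (0 : ℂ) • v) := by
    simpa using hf.differentiableAt (hs.mem_nhds hx)
  exact DifferentiableAt.comp (f := fun ζ : ℂ => x + ζ • v) 0 h1 (by fun_prop)

end Osgood

/-! ### A removable singularity criterion on complex manifolds. -/

section Removable

variable {E : Type*} [NormedAddCommGroup E] [NormedSpace ℂ E]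
  {X : Type*} [TopologicalSpace X] [ChartedSpace E X] [IsManifold 𝓘(ℂ, E) ω X]

/-- A function which is holomorphic off the zero locus of a holomorphic function `t`, and dominated
by the square of `t`, is holomorphic. -/
theorem contMDiffAt_of_norm_le_sq [FiniteDimensional ℂ E] {f t : X → ℂ} {U : Set X} {q : X} {C : ℝ}
    (hU : IsOpen U) (hq : q ∈ U) (ht : ContMDiffOn 𝓘(ℂ, E) 𝓘(ℂ, ℂ) ω t U)
    (hf : ContMDiffOn 𝓘(ℂ, E) 𝓘(ℂ, ℂ) ω f (U ∩ {x | t x ≠ 0}))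
    (hC : ∀ x ∈ U, ‖f x‖ ≤ C * ‖t x‖ ^ 2) :
    ContMDiffAt 𝓘(ℂ, E) 𝓘(ℂ, ℂ) ω f q := by
  set φ := chartAt E q with hφ
  have hV : IsOpen (φ.target ∩ φ.symm ⁻¹' U) := φ.isOpen_inter_preimage_symm hU
  have hdiff : ∀ (g : X → ℂ) (y : E), y ∈ φ.target →
      ContMDiffAt 𝓘(ℂ, E) 𝓘(ℂ, ℂ) ω g (φ.symm y) → DifferentiableAt ℂ (g ∘ φ.symm) y := by
    intro g y hy hg
    have h1 : ContMDiffAt 𝓘(ℂ, E) 𝓘(ℂ, E) ω φ.symm y :=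
      (contMDiffOn_chart_symm (I := 𝓘(ℂ, E)) (n := ω) (x := q)).contMDiffAt
        (φ.open_target.mem_nhds hy)
    exact ((hg.comp y h1).contDiffAt).differentiableAt (by simp)
  have hd : DifferentiableOn ℂ (f ∘ φ.symm) (φ.target ∩ φ.symm ⁻¹' U) := by
    rintro y ⟨hy, hyU⟩
    refine DifferentiableAt.differentiableWithinAt ?_
    have htat : ContMDiffAt 𝓘(ℂ, E) 𝓘(ℂ, ℂ) ω t (φ.symm y) := ht.contMDiffAt (hU.mem_nhds hyU)
    by_cases h0 : t (φ.symm y) = 0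
    -- At a zero of `t`, differentiability gives t = O(‖z - y‖), hence f = O(‖z - y‖²), and the
    -- derivative of `f` exists and is 0.
    · have hfy : f (φ.symm y) = 0 := by
        have := hC _ hyU
        simpa [h0] using this
      have hO := (hdiff t y hy htat).isBigO_sub
      simp only [Function.comp, h0, sub_zero] at hO
      have h1 : (fun z => f (φ.symm z)) =O[𝓝 y] fun z => ‖t (φ.symm z)‖ ^ 2 := by
        refine Asymptotics.IsBigO.of_bound C ?_
        filter_upwards [hV.mem_nhds ⟨hy, hyU⟩] with z hz
        simpa using hC _ hz.2
      have h2 : (fun z => f (φ.symm z)) =O[𝓝 y] fun z => ‖z - y‖ ^ 2 :=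
        h1.trans (hO.norm_norm.pow 2)
      have h3 : (fun z : E => ‖z - y‖ ^ 2) =o[𝓝 y] fun z => z - y :=
        Asymptotics.isLittleO_pow_sub_sub y (by norm_num)
      have : HasFDerivAt (f ∘ φ.symm) (0 : E →L[ℂ] ℂ) y := by
        rw [hasFDerivAt_iff_isLittleO]
        simpa [hfy] using h2.trans_isLittleO h3
      exact this.differentiableAt
    · refine hdiff f y hy (hf.contMDiffAt (Filter.inter_mem (hU.mem_nhds hyU) ?_))
      exact htat.continuousAt.eventually_ne h0
  have ha := hd.analyticOnNhd_of_finiteDimensional hV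
  have hqs : q ∈ φ.source := mem_chart_source E q
  have hqV : φ q ∈ φ.target ∩ φ.symm ⁻¹' U :=
    ⟨φ.map_source hqs, by simpa [φ.left_inv hqs] using hq⟩
  have h1 : ContMDiffAt 𝓘(ℂ, E) 𝓘(ℂ, ℂ) ω (f ∘ φ.symm) (φ q) :=
    (ha _ hqV).contDiffAt.contMDiffAt
  have h2 : ContMDiffAt 𝓘(ℂ, E) 𝓘(ℂ, E) ω φ q :=
    (contMDiffOn_chart (I := 𝓘(ℂ, E)) (n := ω) (x := q)).contMDiffAt (φ.open_source.mem_nhds hqs)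
  refine (h1.comp q h2).congr_of_eventuallyEq ?_
  filter_upwards [φ.open_source.mem_nhds hqs] with x hx
  simp [φ.left_inv hx]

end Removable

/-! ### Points of the torus and holomorphy of its actions. -/

section TorusAction

theorem isOpen_regBase (n : ℕ) : IsOpen (regBase n) := by
  simp only [regBase, ne_eq, ofPred_forall]
  exact isOpen_iInter_of_finite fun i => isOpen_ne_fun (by fun_prop) continuous_const

theorem isOpen_partialBase (n : ℕ) (j : Fin n) : IsOpen (partialBase n j) := by
  simp only [partialBase, ne_eq, ofPred_forall]
  exact isOpen_iInter_of_finite fun i => isOpen_iInter_of_finite fun _ =>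
    isOpen_ne_fun (by fun_prop) continuous_const

theorem mem_regBase_of_mem_partialBase {n : ℕ} {j : Fin n} {t : Fin n → ℂ}
    (ht : t ∈ partialBase n j) (hj : t j ≠ 0) : t ∈ regBase n := fun i => by
  by_cases h : i = j
  · exact h ▸ hj
  · exact ht i h

theorem torusPoint_apply {n : ℕ} {t : Fin n → ℂ} (ht : t ∈ regBase n) (i : Fin n) :
    (torusPoint t i : ℂ) = t i := by
  simp [torusPoint, ht i]

theorem torusPoint_eq {n : ℕ} {t : Fin n → ℂ} {τ : Fin n → ℂˣ} (h : ∀ i, t i = τ i) :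
    torusPoint t = τ := by
  have ht : t ∈ regBase n := fun i => by rw [h i]; exact (τ i).ne_zero
  funext i
  ext
  rw [torusPoint_apply ht, h]

theorem torusPoint_inv {n : ℕ} {t : Fin n → ℂ} (ht : t ∈ regBase n) :
    torusPoint t⁻¹ = (torusPoint t)⁻¹ :=
  torusPoint_eq fun i => by simp [torusPoint_apply ht]

theorem inv_mem_regBase {n : ℕ} {t : Fin n → ℂ} (ht : t ∈ regBase n) : t⁻¹ ∈ regBase n :=
  fun i => inv_ne_zero (ht i)

variable {n : ℕ} {F H : Type*} [NormedAddCommGroup F] [NormedSpace ℂ F]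
    [TopologicalSpace H] {I : ModelWithCorners ℂ F H} {Y : Type*} [TopologicalSpace Y]
    [ChartedSpace H Y] [MulAction (Fin n → ℂˣ) Y]
    {F' H' : Type*} [NormedAddCommGroup F'] [NormedSpace ℂ F']
    [TopologicalSpace H'] {J : ModelWithCorners ℂ F' H'} {M : Type*} [TopologicalSpace M]
    [ChartedSpace H' M]

theorem IsHolomorphicTorusAction.contMDiffAt_smul (h : IsHolomorphicTorusAction n I Y)
    {g : M → Fin n → ℂ} {f : M → Y} {x : M} (hgx : g x ∈ regBase n)
    (hg : ContMDiffAt J 𝓘(ℂ, Fin n → ℂ) ω g x) (hf : ContMDiffAt J I ω f x) :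
    ContMDiffAt J I ω (fun y => torusPoint (g y) • f y) x := by
  have h1 : ContMDiffAt (𝓘(ℂ, Fin n → ℂ).prod I) I ω
      (fun q : (Fin n → ℂ) × Y => torusPoint q.1 • q.2) (g x, f x) :=
    h.contMDiffAt (prod_mem_nhds ((isOpen_regBase n).mem_nhds hgx) Filter.univ_mem)
  exact h1.comp x (hg.prodMk hf)

theorem IsHolomorphicTorusAction.contMDiff_const_smul (h : IsHolomorphicTorusAction n I Y)
    (τ : Fin n → ℂˣ) : ContMDiff I I ω (fun y : Y => τ • y) := fun y => by
  have := h.contMDiffAt_smul (M := Y) (J := I) (g := fun _ i => (τ i : ℂ)) (f := id) (x := y)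
    (fun i => (τ i).ne_zero) contMDiffAt_const contMDiffAt_id
  rwa [torusPoint_eq (τ := τ) fun _ => rfl] at this

end TorusAction

/-! ### Fibrewise scaling in a line bundle. -/

section Scale

variable {X : Type*} {L : X → Type*} [∀ x, AddCommGroup (L x)] [∀ x, Module ℂ (L x)]

/-- Fibrewise multiplication by a scalar on the total space of a bundle. -/
def Bundle.TotalSpace.scale (c : ℂ) (v : TotalSpace ℂ L) : TotalSpace ℂ L :=
  TotalSpace.mk' ℂ v.proj (c • v.snd)

@[simp]
theorem Bundle.TotalSpace.proj_scale (c : ℂ) (v : TotalSpace ℂ L) : (v.scale c).proj = v.proj := rfl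

variable [TopologicalSpace X] [TopologicalSpace (TotalSpace ℂ L)] [∀ x, TopologicalSpace (L x)]
  [FiberBundle ℂ L] [VectorBundle ℂ ℂ L]

theorem Bundle.Trivialization.snd_scale (e : Trivialization ℂ (π ℂ L)) [MemTrivializationAtlas e]
    (c : ℂ) {v : TotalSpace ℂ L} (hv : v.proj ∈ e.baseSet) :
    (e (v.scale c)).2 = c * (e v).2 :=
  (e.linear ℂ hv).map_smul c v.snd

theorem Bundle.Trivialization.snd_zero (e : Trivialization ℂ (π ℂ L)) [MemTrivializationAtlas e]
    {x : X} (hx : x ∈ e.baseSet) : (e (TotalSpace.mk' ℂ x (0 : L x))).2 = 0 :=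
  (e.linear ℂ hx).map_zero

variable {E : Type*} [NormedAddCommGroup E] [NormedSpace ℂ E] [ChartedSpace E X]
  [ContMDiffVectorBundle ω ℂ L 𝓘(ℂ, E)]

theorem ContMDiffAt.scale {c : X → ℂ} {f : X → TotalSpace ℂ L} {x : X}
    (hc : ContMDiffAt 𝓘(ℂ, E) 𝓘(ℂ, ℂ) ω c x)
    (hf : ContMDiffAt 𝓘(ℂ, E) (𝓘(ℂ, E).prod 𝓘(ℂ, ℂ)) ω f x) :
    ContMDiffAt 𝓘(ℂ, E) (𝓘(ℂ, E).prod 𝓘(ℂ, ℂ)) ω (fun y => (f y).scale (c y)) x := by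
  set e := trivializationAt ℂ L (f x).proj
  have hx : (f x).proj ∈ e.baseSet := FiberBundle.mem_baseSet_trivializationAt' _
  have h1 := (e.contMDiffAt_iff (e.mem_source.2 hx)).1 hf
  refine (e.contMDiffAt_iff (f := fun y => (f y).scale (c y)) (e.mem_source.2 hx)).2
    ⟨h1.1, (hc.mul h1.2).congr_of_eventuallyEq ?_⟩
  filter_upwards [h1.1.continuousAt.eventually (e.open_baseSet.mem_nhds hx)] with y hy
  exact e.snd_scale _ hy

end Scale

/-! ### Equivariance and holomorphy of the sweep; distortion of norms by the action. -/

section Family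

variable {n : ℕ} {E : Type*} [NormedAddCommGroup E] [NormedSpace ℂ E]
  {X : Type*} [TopologicalSpace X] [ChartedSpace E X] [MulAction (Fin n → ℂˣ) X]
  {L : X → Type*} [∀ x, AddCommGroup (L x)] [∀ x, Module ℂ (L x)]
  [TopologicalSpace (TotalSpace ℂ L)] [∀ x, TopologicalSpace (L x)] [FiberBundle ℂ L]
  [MulAction (Fin n → ℂˣ) (TotalSpace ℂ L)]
  {pr : X → Fin n → ℂ} {s : X → TotalSpace ℂ L}

namespace IsEquivariantFamily

theorem proj_smul (h : IsEquivariantFamily (E := E) pr L) (τ : Fin n → ℂˣ) (v : TotalSpace ℂ L) :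
    (τ • v).proj = τ • v.proj := by
  obtain ⟨φ, hφ⟩ := h.bundle_action_linear τ v.proj
  exact congrArg TotalSpace.proj (hφ v.snd)

theorem smul_scale (h : IsEquivariantFamily (E := E) pr L) (τ : Fin n → ℂˣ) (c : ℂ)
    (v : TotalSpace ℂ L) : τ • v.scale c = (τ • v).scale c := by
  obtain ⟨φ, hφ⟩ := h.bundle_action_linear τ v.proj
  have h1 : τ • v = TotalSpace.mk' ℂ (τ • v.proj) (φ v.snd) := hφ v.snd
  rw [h1, TotalSpace.scale, hφ, map_smul]
  rfl

theorem smul_zero (h : IsEquivariantFamily (E := E) pr L) (τ : Fin n → ℂˣ) (x : X) :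
    τ • TotalSpace.mk' ℂ x (0 : L x) = TotalSpace.mk' ℂ (τ • x) 0 := by
  obtain ⟨φ, hφ⟩ := h.bundle_action_linear τ x
  rw [hφ, map_zero]

theorem torusPoint_pr_smul (h : IsEquivariantFamily (E := E) pr L) (τ : Fin n → ℂˣ) {x : X}
    (hx : pr x ∈ regBase n) : torusPoint (pr (τ • x)) = τ * torusPoint (pr x) :=
  torusPoint_eq fun i => by
    rw [h.equivariant, Pi.mul_apply, Units.val_mul, torusPoint_apply hx]

theorem pr_torusPoint_inv_smul (h : IsEquivariantFamily (E := E) pr L) {x : X}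
    (hx : pr x ∈ regBase n) : pr ((torusPoint (pr x))⁻¹ • x) = 1 := by
  funext i
  rw [h.equivariant, Pi.inv_apply, Units.val_inv_eq_inv_val, torusPoint_apply hx,
    inv_mul_cancel₀ (hx i), Pi.one_apply]

theorem contMDiff_pr (h : IsEquivariantFamily (E := E) pr L) :
    ContMDiff 𝓘(ℂ, E) 𝓘(ℂ, Fin n → ℂ) ω pr :=
  h.submersion.contMDiff

theorem continuous_pr (h : IsEquivariantFamily (E := E) pr L) : Continuous pr :=
  h.contMDiff_pr.continuous

theorem contMDiff_pr_apply (h : IsEquivariantFamily (E := E) pr L) (i : Fin n) :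
    ContMDiff 𝓘(ℂ, E) 𝓘(ℂ, ℂ) ω fun x => pr x i :=
  contMDiff_pi_space.1 h.contMDiff_pr i

/-- The sweep is equivariant. -/
theorem sweep_smul (h : IsEquivariantFamily (E := E) pr L) (τ : Fin n → ℂˣ) {x : X}
    (hx : pr x ∈ regBase n) : sweep pr s (τ • x) = τ • sweep pr s x := by
  rw [sweep, sweep, h.torusPoint_pr_smul τ hx, mul_smul, mul_inv_rev, mul_smul, inv_smul_smul]

theorem proj_sweep (h : IsEquivariantFamily (E := E) pr L)
    (hs : IsHolomorphicSectionOverSubmanifold (E := E) (pr ⁻¹' {1}) s) {x : X}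
    (hx : pr x ∈ regBase n) : (sweep pr s x).proj = x := by
  obtain ⟨U, -, hyU, σ, hσ, hsσ⟩ := hs _ (h.pr_torusPoint_inv_smul hx)
  rw [sweep, h.proj_smul, hsσ ⟨h.pr_torusPoint_inv_smul hx, hyU⟩, hσ.1 _ hyU, smul_inv_smul]

/-- The map y ↦ pr(y)⁻¹ • y lands in the fibre over 1, where `s` agrees locally with a section `σ`
holomorphic on an open set. Replacing `s` by `σ` makes the sweep a composite of holomorphic maps. -/
theorem contMDiffAt_sweep (h : IsEquivariantFamily (E := E) pr L)
    (hs : IsHolomorphicSectionOverSubmanifold (E := E) (pr ⁻¹' {1}) s) {x : X}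
    (hx : pr x ∈ regBase n) :
    ContMDiffAt 𝓘(ℂ, E) (𝓘(ℂ, E).prod 𝓘(ℂ, ℂ)) ω (sweep pr s) x := by
  obtain ⟨U, hU, hyU, σ, hσ, hsσ⟩ := hs _ (h.pr_torusPoint_inv_smul hx)
  have hinv : ContMDiffAt 𝓘(ℂ, E) 𝓘(ℂ, Fin n → ℂ) ω (fun y => (pr y)⁻¹) x := by
    refine contMDiffAt_pi_space.2 fun i => ?_
    have h1 : ContMDiffAt 𝓘(ℂ, ℂ) 𝓘(ℂ, ℂ) ω (fun z : ℂ => z⁻¹) (pr x i) :=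
      (contDiffAt_inv ℂ (hx i)).contMDiffAt
    exact h1.comp x (h.contMDiff_pr_apply i x)
  have hback : ContMDiffAt 𝓘(ℂ, E) 𝓘(ℂ, E) ω (fun y => torusPoint (pr y)⁻¹ • y) x :=
    h.action_holomorphic.contMDiffAt_smul (inv_mem_regBase hx) hinv contMDiffAt_id
  have hyU' : torusPoint (pr x)⁻¹ • x ∈ U := by rwa [torusPoint_inv hx]
  have hσat : ContMDiffAt 𝓘(ℂ, E) (𝓘(ℂ, E).prod 𝓘(ℂ, ℂ)) ω σ (torusPoint (pr x)⁻¹ • x) :=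
    hσ.2.contMDiffAt (hU.mem_nhds hyU')
  refine (h.bundle_action_holomorphic.contMDiffAt_smul hx (h.contMDiff_pr x)
    (ContMDiffAt.comp (f := fun y => torusPoint (pr y)⁻¹ • y) x hσat hback)).congr_of_eventuallyEq ?_
  filter_upwards [hback.continuousAt.eventually (hU.mem_nhds hyU'),
    h.continuous_pr.continuousAt.eventually ((isOpen_regBase n).mem_nhds hx)] with y hy hyr
  rw [sweep, Function.comp, ← torusPoint_inv hyr]
  congr 1
  exact hsσ ⟨by rw [torusPoint_inv hyr]; exact h.pr_torusPoint_inv_smul hyr, hy⟩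

end IsEquivariantFamily

/-- The action of a group element on a line bundle, read in two trivializations over compact
sets, is bounded. -/
theorem IsEquivariantFamily.eventually_norm_smul_le [T2Space X] [VectorBundle ℂ ℂ L]
    (h : IsEquivariantFamily (E := E) pr L) (τ : Fin n → ℂˣ)
    (e e' : Trivialization ℂ (π ℂ L)) [MemTrivializationAtlas e] [MemTrivializationAtlas e']
    {A A' : Set X} (hA : IsCompact A) (hA' : IsCompact A') (hAe : A ⊆ e.baseSet)
    (hAe' : A' ⊆ e'.baseSet) :
    ∀ᶠ C : ℝ in Filter.atTop, ∀ v : TotalSpace ℂ L, v.proj ∈ A → τ • v.proj ∈ A' →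
      ‖(e' (τ • v)).2‖ ≤ C * ‖(e v).2‖ := by
  have hc : Continuous fun x : X => τ • x :=
    (h.action_holomorphic.contMDiff_const_smul τ).continuous
  have hcL : Continuous fun v : TotalSpace ℂ L => τ • v :=
    (h.bundle_action_holomorphic.contMDiff_const_smul τ).continuous
  have hB : IsCompact (A ∩ (fun x => τ • x) ⁻¹' A') :=
    hA.inter_right (hA'.isClosed.preimage hc)
  -- `w` is the local frame with coordinate 1 in `e`. By linearity of the action on the fibres it is
  -- enough to bound τ • w on a compact set.
  let w : X → TotalSpace ℂ L := fun x => TotalSpace.mk' ℂ x (e.symm x 1)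
  have hw : ContinuousOn w e.baseSet :=
    e.continuousOn_symm.comp (f := fun x => (x, (1 : ℂ))) (by fun_prop) fun x hx => ⟨hx, trivial⟩
  have hcont : ContinuousOn (fun x => (e' (τ • w x)).2) (A ∩ (fun x => τ • x) ⁻¹' A') := by
    refine continuous_snd.comp_continuousOn (e'.continuousOn.comp
      (hcL.comp_continuousOn (hw.mono fun x hx => hAe hx.1)) fun x hx => ?_)
    rw [Trivialization.mem_source, h.proj_smul]
    exact hAe' hx.2
  obtain ⟨C₀, hC₀⟩ := hB.exists_bound_of_continuousOn hcont
  filter_upwards [Filter.eventually_ge_atTop C₀] with C hC v hv hv'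
  have hve := hAe hv
  have hvw : v = (w v.proj).scale (e v).2 := by
    have hev : e v = e ((w v.proj).scale (e v).2) := by
      refine Prod.ext ?_ ?_
      · rw [e.coe_fst' hve, e.coe_fst' (by exact hve)]
        rfl
      · rw [e.snd_scale (v := w v.proj) _ hve]
        simp [w, e.apply_mk_symm hve]
    exact e.injOn (e.mem_source.2 hve) (e.mem_source.2 hve) hev
  have hbound := (hC₀ v.proj ⟨hv, hv'⟩).trans hC
  have hp : (τ • w v.proj).proj ∈ e'.baseSet := by
    rw [h.proj_smul]; exact hAe' hv'
  calc ‖(e' (τ • v)).2‖ = ‖(e v).2‖ * ‖(e' (τ • w v.proj)).2‖ := by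
        conv_lhs => rw [hvw]
        rw [h.smul_scale, e'.snd_scale _ hp, norm_mul]
    _ ≤ ‖(e v).2‖ * C := by gcongr
    _ = _ := mul_comm _ _

end Family

/-! ### Polynomial growth of the sweep along t_j = 0. -/

section Growth

/-- The compact set of base points with `j`-th coordinate in the unit disc and the other
coordinates in the annulus of radii `1 / 2` and `2`. -/
def annularBase (n : ℕ) (j : Fin n) : Set (Fin n → ℂ) :=
  {t | ‖t j‖ ≤ 1 ∧ ∀ i, i ≠ j → 1 / 2 ≤ ‖t i‖ ∧ ‖t i‖ ≤ 2}

theorem isCompact_annularBase (n : ℕ) (j : Fin n) : IsCompact (annularBase n j) := by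
  refine (isCompact_closedBall (0 : Fin n → ℂ) 2).of_isClosed_subset ?_ fun t ht => ?_
  · refine IsClosed.inter (s₁ := {t : Fin n → ℂ | ‖t j‖ ≤ 1})
      (isClosed_le (by fun_prop) continuous_const) ?_
    change IsClosed {t : Fin n → ℂ | ∀ i, i ≠ j → 1 / 2 ≤ ‖t i‖ ∧ ‖t i‖ ≤ 2}
    simp only [ofPred_forall]
    exact isClosed_iInter fun i => isClosed_iInter fun _ =>
      isClosed_Icc.preimage (f := fun t : Fin n → ℂ => ‖t i‖) (by fun_prop)
  · rw [mem_closedBall_zero_iff, pi_norm_le_iff_of_nonneg (by norm_num)]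
    intro i
    by_cases hi : i = j
    · subst hi
      exact ht.1.trans (by norm_num)
    · exact (ht.2 i hi).2

theorem annularBase_mem_nhds {n : ℕ} {j : Fin n} {t : Fin n → ℂ} (hj : t j = 0)
    (ht : ∀ i, i ≠ j → t i = 1) : annularBase n j ∈ 𝓝 t := by
  have hev : ∀ i, Filter.Tendsto (fun t : Fin n → ℂ => ‖t i‖) (𝓝 t) (𝓝 ‖t i‖) := fun i =>
    (by fun_prop : Continuous fun t : Fin n → ℂ => ‖t i‖).tendsto t
  refine Filter.inter_mem ((hev j).eventually_le_const (by simp [hj])) ?_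
  refine Filter.eventually_all.2 fun i => ?_
  by_cases hi : i = j
  · exact Filter.Eventually.of_forall fun _ h => absurd hi h
  · filter_upwards [(hev i).eventually_const_le (u := 1 / 2) (by rw [ht i hi]; norm_num),
      (hev i).eventually_le_const (u := 2) (by rw [ht i hi]; norm_num)] with u h1 h2 _
    exact ⟨h1, h2⟩

theorem mem_regBase_of_mem_annularBase {n : ℕ} {j : Fin n} {t : Fin n → ℂ}
    (ht : t ∈ annularBase n j) (hj : t j ≠ 0) : t ∈ regBase n := fun i => by
  by_cases hi : i = j
  · exact hi ▸ hj
  · exact norm_pos_iff.1 (lt_of_lt_of_le (by norm_num) (ht.2 i hi).1)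

/-- Compact subsets of `X` are covered by finitely many compact sets over which the bundle is
trivial. -/
theorem exists_finset_compact_cover (E : Type*) [NormedAddCommGroup E] [NormedSpace ℂ E]
    [FiniteDimensional ℂ E] {X : Type*} [TopologicalSpace X] [ChartedSpace E X]
    {L : X → Type*} [∀ x, Zero (L x)] [TopologicalSpace (TotalSpace ℂ L)]
    [∀ x, TopologicalSpace (L x)] [FiberBundle ℂ L] {K : Set X} (hK : IsCompact K) :
    ∃ (A : X → Set X) (T : Finset X), (∀ x, IsCompact (A x)) ∧
      (∀ x, A x ⊆ (trivializationAt ℂ L x).baseSet) ∧ K ⊆ ⋃ x ∈ T, interior (A x) := by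
  have : ProperSpace E := FiniteDimensional.proper ℂ E
  have : LocallyCompactSpace X := ChartedSpace.locallyCompactSpace E X
  choose A hAx hAs hA using fun x : X => local_compact_nhds
    ((trivializationAt ℂ L x).open_baseSet.mem_nhds (FiberBundle.mem_baseSet_trivializationAt' x))
  obtain ⟨T, -, hT⟩ := hK.elim_nhds_subcover (fun x => interior (A x)) fun x _ =>
    interior_mem_nhds.2 (hAx x)
  exact ⟨A, T, hA, hAs, hT⟩

variable {n : ℕ} {E : Type*} [NormedAddCommGroup E] [NormedSpace ℂ E] [FiniteDimensional ℂ E]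
  {X : Type*} [TopologicalSpace X] [T2Space X] [ChartedSpace E X] [MulAction (Fin n → ℂˣ) X]
  {L : X → Type*} [∀ x, AddCommGroup (L x)] [∀ x, Module ℂ (L x)]
  [TopologicalSpace (TotalSpace ℂ L)] [∀ x, TopologicalSpace (L x)] [FiberBundle ℂ L]
  [VectorBundle ℂ ℂ L]
  [MulAction (Fin n → ℂˣ) (TotalSpace ℂ L)]
  {pr : X → Fin n → ℂ} {s : X → TotalSpace ℂ L}

/-- The sweep of a holomorphic section has at most polynomial growth along `t_j = 0`. -/
theorem IsEquivariantFamily.exists_sweep_growth (h : IsEquivariantFamily (E := E) pr L)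
    (hs : IsHolomorphicSectionOverSubmanifold (E := E) (pr ⁻¹' {1}) s) (j : Fin n) :
    ∃ (M : ℕ) (C : ℝ), ∀ q, pr q j = 0 → (∀ i, i ≠ j → pr q i = 1) →
      ∃ (x₀ : X) (U : Set X), IsOpen U ∧ q ∈ U ∧ U ⊆ (trivializationAt ℂ L x₀).baseSet ∧
        ∀ x ∈ U, pr x j ≠ 0 → pr x ∈ regBase n ∧
          ‖pr x j‖ ^ M * ‖(trivializationAt ℂ L x₀ (sweep pr s x)).2‖ ≤ C := by
  have hK : IsCompact (pr ⁻¹' annularBase n j) :=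
    h.proper.isCompact_preimage (isCompact_annularBase n j)
  obtain ⟨A, T, hA, hAe, hT⟩ := exists_finset_compact_cover (L := L) E hK
  have hcj : Continuous fun x => ‖pr x j‖ := (h.contMDiff_pr_apply j).continuous.norm
  have hclosed : IsClosed {x | 1 / 2 ≤ ‖pr x j‖} := isClosed_le continuous_const hcj
  set τ : Fin n → ℂˣ := Pi.mulSingle j (Units.mk0 (1 / 2) (by norm_num)) with hτ
  obtain ⟨D, hD, hD1⟩ : ∃ D : ℝ, (∀ i ∈ T, ∀ k ∈ T, ∀ v : TotalSpace ℂ L, v.proj ∈ A k →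
      τ • v.proj ∈ A i → ‖(trivializationAt ℂ L i (τ • v)).2‖ ≤
        D * ‖(trivializationAt ℂ L k v).2‖) ∧ 0 ≤ D := by
    -- Each pair of trivializations admits all large constants, so finitely many pairs share one,
    -- which may be taken nonnegative.
    refine (Filter.Eventually.and ?_ (Filter.eventually_ge_atTop 0)).exists (f := Filter.atTop)
    refine (Filter.eventually_all_finset T).2 fun i _ =>
      (Filter.eventually_all_finset T).2 fun k _ => ?_
    exact h.eventually_norm_smul_le τ _ _ (hA k) (hA i) (hAe k) (hAe i)
  -- The outer shell 1/2 ≤ |t_j| ≤ 1 is compact and lies in the regular locus, where the sweep is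
  -- continuous.
  obtain ⟨C, hC⟩ : ∃ C : ℝ, ∀ i ∈ T, ∀ x ∈ pr ⁻¹' annularBase n j, 1 / 2 ≤ ‖pr x j‖ → x ∈ A i →
      ‖(trivializationAt ℂ L i (sweep pr s x)).2‖ ≤ C := by
    refine Filter.Eventually.exists (f := Filter.atTop) ?_
    refine (Filter.eventually_all_finset T).2 fun i _ => ?_
    have hreg : ∀ x ∈ pr ⁻¹' annularBase n j ∩ {x | 1 / 2 ≤ ‖pr x j‖} ∩ A i,
        pr x ∈ regBase n := fun x hx =>
      mem_regBase_of_mem_annularBase hx.1.1 (norm_pos_iff.1 (lt_of_lt_of_le (by norm_num) hx.1.2))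
    have hcont : ContinuousOn (fun x => (trivializationAt ℂ L i (sweep pr s x)).2)
        (pr ⁻¹' annularBase n j ∩ {x | 1 / 2 ≤ ‖pr x j‖} ∩ A i) := by
      refine continuous_snd.comp_continuousOn
        ((trivializationAt ℂ L i).continuousOn.comp (t := (trivializationAt ℂ L i).source)
          (fun x hx => (h.contMDiffAt_sweep hs (hreg x hx)).continuousAt.continuousWithinAt)
          fun x hx => ?_)
      rw [Trivialization.mem_source, h.proj_sweep hs (hreg x hx)]
      exact hAe i hx.2
    obtain ⟨C₀, hC₀⟩ := ((hK.inter_right hclosed).inter (hA i)).exists_bound_of_continuousOn hcont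
    filter_upwards [Filter.eventually_ge_atTop C₀] with C hC x hx hx' hxA
    exact (hC₀ x ⟨⟨hx, hx'⟩, hxA⟩).trans hC
  obtain ⟨M, hM⟩ := pow_unbounded_of_one_lt D (one_lt_two : (1 : ℝ) < 2)
  -- Induction on the number of halvings, with the same `C` throughout: the factor 2^M > D gained
  -- from |t_j|^M absorbs the distortion `D`.
  have main : ∀ k : ℕ, ∀ x ∈ pr ⁻¹' annularBase n j, (1 / 2 : ℝ) ^ (k + 1) ≤ ‖pr x j‖ →
      ∀ i ∈ T, x ∈ A i → ‖pr x j‖ ^ M * ‖(trivializationAt ℂ L i (sweep pr s x)).2‖ ≤ C := by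
    intro k
    induction k with
    | zero =>
      intro x hx hx' i hi hxA
      rw [zero_add, pow_one] at hx'
      calc _ ≤ 1 * ‖(trivializationAt ℂ L i (sweep pr s x)).2‖ := by
            gcongr
            exact pow_le_one₀ (norm_nonneg _) hx.1
        _ ≤ C := by rw [one_mul]; exact hC i hi x hx hx' hxA
    | succ k ih =>
      intro x hx hx' i hi hxA
      rcases le_or_gt (1 / 2) ‖pr x j‖ with hge | hlt
      · calc _ ≤ 1 * ‖(trivializationAt ℂ L i (sweep pr s x)).2‖ := by
              gcongr
              exact pow_le_one₀ (norm_nonneg _) hx.1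
          _ ≤ C := by rw [one_mul]; exact hC i hi x hx hge hxA
      -- The point y has twice the j-th coordinate of x. Since |t_j(x)| < 1/2, it is still in K.
      · obtain ⟨y, rfl⟩ : ∃ y, τ • y = x := ⟨τ⁻¹ • x, smul_inv_smul τ x⟩
        have hj : ‖pr (τ • y) j‖ = 1 / 2 * ‖pr y j‖ := by
          rw [h.equivariant, norm_mul]
          simp [hτ]
        have hne : ∀ l, l ≠ j → pr (τ • y) l = pr y l := fun l hl => by
          rw [h.equivariant, hτ, Pi.mulSingle_eq_of_ne hl, Units.val_one, one_mul]
        have hyj : (1 / 2 : ℝ) ^ (k + 1) ≤ ‖pr y j‖ := by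
          rw [pow_succ (1 / 2 : ℝ) (k + 1), hj] at hx'
          linarith
        have hy : y ∈ pr ⁻¹' annularBase n j := by
          refine ⟨by linarith, fun l hl => ?_⟩
          rw [← hne l hl]
          exact hx.2 l hl
        have hy0 : pr y j ≠ 0 := norm_pos_iff.1 (lt_of_lt_of_le (by positivity) hyj)
        have hyr := mem_regBase_of_mem_annularBase hy hy0
        -- The trivialization around y may differ from the one around x; hence `D` was chosen for
        -- all pairs.
        obtain ⟨l, hl, hyl⟩ := mem_iUnion₂.1 (hT hy)
        have hyA := interior_subset hyl
        have hstep := hD i hi l hl (sweep pr s y) (by rwa [h.proj_sweep hs hyr])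
          (by rwa [h.proj_sweep hs hyr])
        rw [h.sweep_smul τ hyr, hj]
        calc (1 / 2 * ‖pr y j‖) ^ M * ‖(trivializationAt ℂ L i (τ • sweep pr s y)).2‖
            ≤ (1 / 2 * ‖pr y j‖) ^ M * (2 ^ M * ‖(trivializationAt ℂ L l (sweep pr s y)).2‖) := by
              gcongr
              exact hstep.trans (by gcongr)
          _ = ‖pr y j‖ ^ M * ‖(trivializationAt ℂ L l (sweep pr s y)).2‖ := by
              rw [← mul_assoc, ← mul_pow]
              congr 2
              ring
          _ ≤ C := ih y hy hyj l hl hyA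
  refine ⟨M, C, fun q hqj hq => ?_⟩
  have hKq : pr ⁻¹' annularBase n j ∈ 𝓝 q :=
    h.continuous_pr.continuousAt (annularBase_mem_nhds hqj hq)
  obtain ⟨i, hi, hqi⟩ := mem_iUnion₂.1 (hT (mem_of_mem_nhds hKq))
  refine ⟨i, interior (A i) ∩ interior (pr ⁻¹' annularBase n j), isOpen_interior.inter
    isOpen_interior, ⟨hqi, mem_interior_iff_mem_nhds.2 hKq⟩,
    fun x hx => hAe i (interior_subset hx.1), fun x hx hxj => ?_⟩
  have hxK := interior_subset hx.2
  refine ⟨mem_regBase_of_mem_annularBase hxK hxj, ?_⟩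
  obtain ⟨k, hk⟩ := exists_pow_lt_of_lt_one (norm_pos_iff.2 hxj) (by norm_num : (1 / 2 : ℝ) < 1)
  refine main k x hxK (le_trans ?_ hk.le) i hi (interior_subset hx.1)
  exact pow_le_pow_of_le_one (by norm_num) (by norm_num) (Nat.le_succ k)

end Growth

/-! ### Extension by zero of t_j^k times the sweep. -/

section Extension

variable {n : ℕ} {X : Type*} {L : X → Type*} [∀ x, AddCommGroup (L x)] [∀ x, Module ℂ (L x)]
  {pr : X → Fin n → ℂ} {s : X → TotalSpace ℂ L}

theorem twist_neg_natCast (j : Fin n) (k : ℕ) (σ : X → TotalSpace ℂ L) (x : X) :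
    twist pr j (-(k : ℤ)) σ x = (σ x).scale (pr x j ^ k) := by
  rw [twist, neg_neg, zpow_natCast]
  rfl

variable [MulAction (Fin n → ℂˣ) X] [MulAction (Fin n → ℂˣ) (TotalSpace ℂ L)]

open Classical in
/-- The section `t_j ^ k s̃`, extended by zero to the locus `t_j = 0`. -/
noncomputable def sweepExtension (pr : X → Fin n → ℂ) (j : Fin n) (k : ℕ)
    (s : X → TotalSpace ℂ L) (x : X) : TotalSpace ℂ L :=
  if pr x j = 0 then TotalSpace.mk' ℂ x 0 else (sweep pr s x).scale (pr x j ^ k)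

theorem sweepExtension_of_eq_zero {j : Fin n} {x : X} (hx : pr x j = 0) (k : ℕ) :
    sweepExtension pr j k s x = TotalSpace.mk' ℂ x 0 := if_pos hx

theorem sweepExtension_of_ne_zero {j : Fin n} {x : X} (hx : pr x j ≠ 0) (k : ℕ) :
    sweepExtension pr j k s x = (sweep pr s x).scale (pr x j ^ k) := if_neg hx

variable {E : Type*} [NormedAddCommGroup E] [NormedSpace ℂ E]
  [TopologicalSpace X] [ChartedSpace E X] [TopologicalSpace (TotalSpace ℂ L)]
  [∀ x, TopologicalSpace (L x)] [FiberBundle ℂ L]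

namespace IsEquivariantFamily

variable (h : IsEquivariantFamily (E := E) pr L)
  (hs : IsHolomorphicSectionOverSubmanifold (E := E) (pr ⁻¹' {1}) s)
include h

/-- The condition τ j = 1 leaves t_j^k unchanged. Such τ move a point with t_j = 0 to one whose
other coordinates are 1, where the growth bound is available. -/
theorem sweepExtension_smul {j : Fin n} {τ : Fin n → ℂˣ} (hτ : τ j = 1) (k : ℕ) {x : X}
    (hx : pr x ∈ partialBase n j) :
    sweepExtension pr j k s (τ • x) = τ • sweepExtension pr j k s x := by
  have hj : pr (τ • x) j = pr x j := by rw [h.equivariant, hτ, Units.val_one, one_mul]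
  by_cases h0 : pr x j = 0
  · rw [sweepExtension_of_eq_zero (hj.trans h0), sweepExtension_of_eq_zero h0, h.smul_zero]
  · rw [sweepExtension_of_ne_zero (hj ▸ h0), sweepExtension_of_ne_zero h0, hj, h.smul_scale,
      h.sweep_smul τ (mem_regBase_of_mem_partialBase hx h0)]

include hs

theorem proj_sweepExtension (j : Fin n) (k : ℕ) {x : X} (hx : pr x ∈ partialBase n j) :
    (sweepExtension pr j k s x).proj = x := by
  by_cases h0 : pr x j = 0
  · rw [sweepExtension_of_eq_zero h0]
  · rw [sweepExtension_of_ne_zero h0, TotalSpace.proj_scale,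
      h.proj_sweep hs (mem_regBase_of_mem_partialBase hx h0)]

variable [VectorBundle ℂ ℂ L] [ContMDiffVectorBundle ω ℂ L 𝓘(ℂ, E)]

theorem contMDiffAt_sweepExtension_of_mem_regBase (j : Fin n) (k : ℕ) {x : X}
    (hx : pr x ∈ regBase n) :
    ContMDiffAt 𝓘(ℂ, E) (𝓘(ℂ, E).prod 𝓘(ℂ, ℂ)) ω (sweepExtension pr j k s) x := by
  have hc : ContMDiffAt 𝓘(ℂ, E) 𝓘(ℂ, ℂ) ω (fun y => pr y j ^ k) x :=
    (h.contMDiff_pr_apply j x).pow k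
  refine (hc.scale (h.contMDiffAt_sweep hs hx)).congr_of_eventuallyEq ?_
  filter_upwards [(h.contMDiff_pr_apply j).continuous.continuousAt.eventually_ne (hx j)] with y hy
  exact sweepExtension_of_ne_zero hy k

variable [IsManifold 𝓘(ℂ, E) ω X]

/-- Of the exponent M + 2, the part M cancels the growth of the sweep and the part 2 gives the
quadratic decay required by `contMDiffAt_of_norm_le_sq`. -/
theorem contMDiffAt_sweepExtension_of_growth [FiniteDimensional ℂ E] {j : Fin n} {M : ℕ} {C : ℝ}
    {q x₀ : X} {U : Set X} (hU : IsOpen U) (hq : q ∈ U) (hqj : pr q ∈ partialBase n j)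
    (hUe : U ⊆ (trivializationAt ℂ L x₀).baseSet)
    (hb : ∀ x ∈ U, pr x j ≠ 0 → pr x ∈ regBase n ∧
      ‖pr x j‖ ^ M * ‖(trivializationAt ℂ L x₀ (sweep pr s x)).2‖ ≤ C) :
    ContMDiffAt 𝓘(ℂ, E) (𝓘(ℂ, E).prod 𝓘(ℂ, ℂ)) ω (sweepExtension pr j (M + 2) s) q := by
  set e := trivializationAt ℂ L x₀
  set σ := sweepExtension pr j (M + 2) s with hσ
  have hproj : ∀ x, pr x ∈ partialBase n j → (σ x).proj = x := fun x hx =>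
    h.proj_sweepExtension hs j _ hx
  have hsrc : ∀ x ∈ U, pr x ∈ partialBase n j → σ x ∈ e.source := fun x hx hx' => by
    rw [e.mem_source, hproj x hx']
    exact hUe hx
  rw [e.contMDiffAt_iff (hsrc q hq hqj)]
  constructor
  · refine contMDiffAt_id.congr_of_eventuallyEq ?_
    filter_upwards [h.continuous_pr.continuousAt.eventually
      ((isOpen_partialBase n j).mem_nhds hqj)] with x hx
    exact hproj x hx
  · refine contMDiffAt_of_norm_le_sq (t := fun x => pr x j) (C := max C 0) hU hq
      (h.contMDiff_pr_apply j).contMDiffOn (fun x hx => ?_) fun x hx => ?_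
    · have hxr := (hb x hx.1 hx.2).1
      exact ((e.contMDiffAt_iff (hsrc x hx.1 fun i _ => hxr i)).1
        (h.contMDiffAt_sweepExtension_of_mem_regBase hs j _ hxr)).2.contMDiffWithinAt
    · by_cases h0 : pr x j = 0
      · rw [hσ, sweepExtension_of_eq_zero h0, e.snd_zero (hUe hx), norm_zero]
        positivity
      · obtain ⟨hxr, hx'⟩ := hb x hx h0
        rw [hσ, sweepExtension_of_ne_zero h0,
          e.snd_scale _ (by rw [h.proj_sweep hs hxr]; exact hUe hx), norm_mul, norm_pow]
        calc ‖pr x j‖ ^ (M + 2) * ‖(e (sweep pr s x)).2‖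
            = (‖pr x j‖ ^ M * ‖(e (sweep pr s x)).2‖) * ‖pr x j‖ ^ 2 := by ring
          _ ≤ max C 0 * ‖pr x j‖ ^ 2 := by
            gcongr
            exact hx'.trans (le_max_left _ _)

/-- For some `k`, the section `t_j ^ k s̃` extends holomorphically by zero. -/
theorem exists_isHolomorphicSectionOn_sweepExtension [FiniteDimensional ℂ E] [T2Space X]
    (j : Fin n) : ∃ k : ℕ,
      IsHolomorphicSectionOn (E := E) (pr ⁻¹' partialBase n j) (sweepExtension pr j k s) := by
  obtain ⟨M, C, hMC⟩ := h.exists_sweep_growth hs j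
  refine ⟨M + 2, fun x hx => h.proj_sweepExtension hs j _ hx, fun x hx => ?_⟩
  refine ContMDiffAt.contMDiffWithinAt ?_
  by_cases h0 : pr x j = 0
  -- τ brings the coordinates other than the j-th to 1; holomorphy there is transported back to x by
  -- τ⁻¹.
  · set τ : Fin n → ℂˣ := fun i => if hi : i = j then 1 else (Units.mk0 (pr x i) (hx i hi))⁻¹
      with hτ
    have hτj : τ j = 1 := by simp [hτ]
    have hqj : pr (τ • x) j = 0 := by rw [h.equivariant, h0, mul_zero]
    have hqi : ∀ i, i ≠ j → pr (τ • x) i = 1 := fun i hi => by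
      simp [h.equivariant, hτ, hi, hx i hi]
    obtain ⟨x₀, U, hU, hqU, hUe, hb⟩ := hMC (τ • x) hqj hqi
    have hq := h.contMDiffAt_sweepExtension_of_growth hs hU hqU
      (fun i hi => by rw [hqi i hi]; exact one_ne_zero) hUe hb
    have h1 := hq.comp x (h.action_holomorphic.contMDiff_const_smul τ x)
    have h2 := (h.bundle_action_holomorphic.contMDiff_const_smul τ⁻¹).contMDiffAt.comp x h1
    refine h2.congr_of_eventuallyEq ?_
    filter_upwards [h.continuous_pr.continuousAt.eventually
      ((isOpen_partialBase n j).mem_nhds hx)] with y hy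
    simp only [Function.comp]
    rw [h.sweepExtension_smul hτj _ hy, inv_smul_smul]
  · exact h.contMDiffAt_sweepExtension_of_mem_regBase hs j _ (mem_regBase_of_mem_partialBase hx h0)

end IsEquivariantFamily

end Extension

/-- The fixed point hypothesis `hmild` is not needed: since `pr` is proper, the orbits of the `j`-th
factor along which the sweep approaches `t_j = 0` stay in a compact set, on which the action on `L`
distorts trivializations by at most a constant factor per step. This bounds the sweep by a power
of `t_j`. -/
theorem proposition2p4 {n : ℕ}
    {E : Type*} [NormedAddCommGroup E] [NormedSpace ℂ E] [FiniteDimensional ℂ E]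
    {X : Type*} [TopologicalSpace X] [T2Space X] [SecondCountableTopology X]
    [ChartedSpace E X] [IsManifold 𝓘(ℂ, E) ω X]
    {L : X → Type*} [∀ x, AddCommGroup (L x)] [∀ x, Module ℂ (L x)]
    [TopologicalSpace (TotalSpace ℂ L)] [∀ x, TopologicalSpace (L x)]
    [FiberBundle ℂ L] [VectorBundle ℂ ℂ L] [ContMDiffVectorBundle ω ℂ L 𝓘(ℂ, E)]
    [MulAction (Fin n → ℂˣ) X] [MulAction (Fin n → ℂˣ) (TotalSpace ℂ L)]
    (pr : X → Fin n → ℂ)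
    (hfam : IsEquivariantFamily (E := E) pr L)
    (hmild : MildTechnicalCondition (E := E) pr)
    (s : X → TotalSpace ℂ L)
    (hs : IsHolomorphicSectionOverSubmanifold (E := E) (pr ⁻¹' {1}) s)
    (j : Fin n) :
    ∃ ℓ : ℤ, ∃ σ : X → TotalSpace ℂ L,
      IsHolomorphicSectionOn (E := E) (pr ⁻¹' partialBase n j) σ ∧
      EqOn σ (twist pr j ℓ (sweep pr s)) (pr ⁻¹' regBase n) := by
  obtain ⟨k, hk⟩ := hfam.exists_isHolomorphicSectionOn_sweepExtension hs j
  refine ⟨-(k : ℤ), sweepExtension pr j k s, hk, fun x hx => ?_⟩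
  rw [sweepExtension_of_ne_zero (hx j), twist_neg_natCast]
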